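/- A family of points in $\mathbb{R}^3$ is convexly independent if no point of the family lies in the convex hull of the other points of the family (so the points are pairwise distinct and are the vertices of their convex hull). For a finite set $P\subset\mathbb{R}^3$ let $E(P)$ be the maximum number of unordered pairs of distinct points of $P$ such that the midpoints of these pairs are convexly independent, and let $E_3(n)=\max\{E(P) : P\subset\mathbb{R}^3,\ |P|=n\}$. Then $$\left\lfloor \tfrac13 n^2\right\rfloor\le E_3(n)\le \tfrac38 n^2+O(n^{3/2}),$$ that is, the lower bound holds for every integer $n\ge 0$, and there is an absolute constant $C$ such that $E_3(n)\le \frac38 n^2+C n^{3/2}$ for every integer $n\ge 0$. -/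

import Mathlib

namespace MidpointGraphs

/-- The midpoint of an unordered pair of points of `ℝ^d`. -/
noncomputable def pairMidpoint {d : ℕ} (e : Sym2 (EuclideanSpace ℝ (Fin d))) :
    EuclideanSpace ℝ (Fin d) :=
  Sym2.lift ⟨fun p q => midpoint ℝ p q, fun p q => midpoint_comm (R := ℝ) p q⟩ e

/-- The midpoints of the pairs in `S` are convexly independent: the midpoint of a pair in `S` never
lies in the convex hull of the midpoints of other pairs in `S`. In particular different pairs have
different midpoints. -/
def MidpointsConvexIndependent {d : ℕ} (S : Finset (Sym2 (EuclideanSpace ℝ (Fin d)))) : Prop :=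
  ConvexIndependent ℝ (fun e : S => pairMidpoint (e : Sym2 (EuclideanSpace ℝ (Fin d))))

open Classical in
/-- The set of all unordered pairs of two different points of `P`. -/
noncomputable def pairs {d : ℕ} (P : Finset (EuclideanSpace ℝ (Fin d))) :
    Finset (Sym2 (EuclideanSpace ℝ (Fin d))) :=
  P.sym2.filter (fun e => ¬ e.IsDiag)

open Classical in
/-- `E(P)`: the maximum number of pairs of points of `P` whose midpoints are convexly
independent. -/
noncomputable def maxPairs {d : ℕ} (P : Finset (EuclideanSpace ℝ (Fin d))) : ℕ :=
  ((pairs P).powerset.filter MidpointsConvexIndependent).sup Finset.card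

/-- `E_d(n)`: the maximum of `E(P)` over all sets `P` of `n` points in `ℝ^d`. -/
noncomputable def E (d n : ℕ) : ℕ :=
  sSup {m : ℕ | ∃ P : Finset (EuclideanSpace ℝ (Fin d)), P.card = n ∧ maxPairs P = m}

theorem maxPairs_le {d : ℕ} (P : Finset (EuclideanSpace ℝ (Fin d))) :
    maxPairs P ≤ (P.card + 1).choose 2 := by
  classical
  refine Finset.sup_le fun S hS => ?_
  have h1 : S ⊆ pairs P := Finset.mem_powerset.mp (Finset.mem_filter.mp hS).1
  rw [← Finset.card_sym2]
  exact Finset.card_le_card (h1.trans (Finset.filter_subset _ _))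

/-- The supremum defining `E_d(n)` is a true maximum when `d ≥ 1`. -/
theorem isGreatest_E (d n : ℕ) (hd : 0 < d) :
    IsGreatest {m : ℕ | ∃ P : Finset (EuclideanSpace ℝ (Fin d)), P.card = n ∧ maxPairs P = m}
      (E d n) := by
  have hb : BddAbove
      {m : ℕ | ∃ P : Finset (EuclideanSpace ℝ (Fin d)), P.card = n ∧ maxPairs P = m} := by
    refine ⟨(n + 1).choose 2, ?_⟩
    rintro m ⟨P, rfl, rfl⟩
    exact maxPairs_le P
  have : Nonempty (Fin d) := ⟨⟨0, hd⟩⟩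
  have : Infinite (EuclideanSpace ℝ (Fin d)) := Module.Free.infinite ℝ _
  obtain ⟨P, hP⟩ := Infinite.exists_subset_card_eq (EuclideanSpace ℝ (Fin d)) n
  exact ⟨Nat.sSup_mem ⟨_, P, hP, rfl⟩ hb, fun m hm => le_csSup hb hm⟩

end MidpointGraphs

/-!
Draw the chosen pairs as a graph on the points. By Hahn-Banach the midpoints are convexly
independent iff each edge `xy` has a linear functional `f` for which `f x + f y` is larger than on
every other edge. Hence the neighbours of a vertex are convexly independent, and an edge never meets
the convex hull of the common neighbours of its ends.

In dimension at most three, take a Radon partition of a clique of size five. Its smaller part is not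
an edge, so some vertex `v` of the clique lies in the convex hull of the other four. If `w ≠ v` is
also adjacent to those four, they and `w` form a clique of size five, which again has a vertex in
the convex hull of the others; exchanging points in convex combinations then puts `v` into the
convex hull of `w` and three of the four. The fourth one, `k`, is a common neighbour of all of
these, so the neighbours of `k` are not convexly independent. So `v` is the only common neighbour of
the other four vertices, and deleting these four costs at most three edges per remaining vertex,
plus seven. Without a clique of size five Turán's theorem applies.

For the lower bound the classes of the Turán graph with three classes are placed on three parabola
arcs, chosen so that explicit functionals expose all the edges.
-/

namespace MidpointGraphs

open Finset

section Convexity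

variable {𝕜 V : Type*} [Field 𝕜] [LinearOrder 𝕜] [IsStrictOrderedRing 𝕜] [AddCommGroup V]
  [Module 𝕜 V] [DecidableEq V]

theorem exists_mem_convexHull_insert_erase {Q : Finset V} {v w : V}
    (hv : v ∈ convexHull 𝕜 (Q : Set V)) (hw : w ∈ convexHull 𝕜 (Q : Set V)) :
    ∃ u ∈ Q, v ∈ convexHull 𝕜 (insert w (Q.erase u) : Set V) := by
  obtain ⟨a, ha, ha1, rfl⟩ := Finset.mem_convexHull'.1 hv
  obtain ⟨b, hb, hb1, hbw⟩ := Finset.mem_convexHull'.1 hw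
  have hpos : {k ∈ Q | 0 < b k}.Nonempty := by
    obtain ⟨k, hk, hbk⟩ := exists_lt_of_sum_lt (s := Q) (f := 0) (g := b) (by simp [hb1])
    exact ⟨k, mem_filter.2 ⟨hk, hbk⟩⟩
  obtain ⟨u, hu, hmin⟩ := exists_min_image _ (fun k => a k / b k) hpos
  obtain ⟨huQ, hbu⟩ := mem_filter.1 hu
  set r := a u / b u
  have hr : 0 ≤ r := div_nonneg (ha u huQ) hbu.le
  have hc : ∀ k ∈ Q, 0 ≤ a k - r * b k := by
    intro k hk
    obtain hbk | hbk := (hb k hk).eq_or_lt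
    · simpa [← hbk] using ha k hk
    · have := (le_div_iff₀ hbk).1 (hmin k (mem_filter.2 ⟨hk, hbk⟩))
      linarith
  have hcu : a u - r * b u = 0 := by rw [div_mul_cancel₀ _ hbu.ne', sub_self]
  have hc1 : r + ∑ k ∈ Q.erase u, (a k - r * b k) = 1 := by
    rw [sum_erase Q (f := fun k => a k - r * b k) hcu, sum_sub_distrib, ← mul_sum, ha1, hb1]
    ring
  have hsum : ∑ k ∈ Q, a k • k = r • w + ∑ k ∈ Q.erase u, (a k - r * b k) • k := by
    rw [sum_erase _ (by rw [hcu, zero_smul])]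
    simp only [sub_smul, mul_smul, sum_sub_distrib, ← smul_sum, hbw, add_sub_cancel]
  refine ⟨u, huQ, ?_⟩
  rw [hsum]
  have hmem := (convex_convexHull 𝕜 (insert w (Q.erase u) : Set V)).sum_mem
    (t := (Q.erase u).insertNone) (w := fun o => o.elim r fun k => a k - r * b k)
    (z := fun o => o.elim w id)
    (forall_mem_insertNone.2 ⟨hr, fun k hk => hc k (mem_of_mem_erase hk)⟩)
    ((sum_insertNone _ _).trans hc1)
    (forall_mem_insertNone.2 ⟨subset_convexHull 𝕜 _ (Set.mem_insert _ _),
      fun k hk => subset_convexHull 𝕜 _ (Set.mem_insert_of_mem _ hk)⟩)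
  rw [sum_insertNone] at hmem
  exact hmem

theorem exists_mem_convexHull_insert_erase_of_mem_convexHull_erase {Q : Finset V} {u v w : V}
    (hv : v ∈ convexHull 𝕜 (Q : Set V)) (hw : w ∉ Q) (hu : u ∈ insert w Q)
    (huQ : u ∈ convexHull 𝕜 ((insert w Q).erase u : Set V)) :
    ∃ k ∈ Q, v ∈ convexHull 𝕜 (insert w (Q.erase k) : Set V) := by
  obtain rfl | hu := mem_insert.1 hu
  · rw [erase_insert hw] at huQ
    exact exists_mem_convexHull_insert_erase hv huQ
  · rw [erase_insert_of_ne (ne_of_mem_of_not_mem hu hw).symm, coe_insert] at huQ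
    refine ⟨u, hu, convexHull_min (fun z hz => ?_) (convex_convexHull 𝕜 _) hv⟩
    obtain rfl | hzu := eq_or_ne z u
    · exact huQ
    · exact subset_convexHull 𝕜 _ (Set.mem_insert_of_mem _ (mem_erase.2 ⟨hzu, hz⟩))

theorem exists_subset_inter_convexHull_sdiff_nonempty [FiniteDimensional 𝕜 V] {s : Finset V}
    (hs : Module.finrank 𝕜 V + 2 ≤ #s) :
    ∃ t ⊆ s, 2 * #t ≤ #s ∧
      (convexHull 𝕜 (t : Set V) ∩ convexHull 𝕜 ((s \ t : Finset V) : Set V)).Nonempty := by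
  have hdep : ¬ AffineIndependent 𝕜 ((↑) : s → V) := by
    intro h
    have hcard := h.card_le_finrank_succ
    have hle := Submodule.finrank_le (vectorSpan 𝕜 (Set.range ((↑) : s → V)))
    rw [Fintype.card_coe] at hcard
    omega
  obtain ⟨I, hI⟩ := Convex.radon_partition hdep
  lift I to Finset s using I.toFinite
  obtain ⟨t, hts, ht, htc⟩ : ∃ t ⊆ s, (↑) '' (I : Set s) = (t : Set V) ∧
      (↑) '' (I : Set s)ᶜ = ((s \ t : Finset V) : Set V) :=
    ⟨I.map (.subtype _), map_subtype_subset I, by simp,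
      by simp [Set.image_compl_eq_range_sdiff_image Subtype.val_injective]⟩
  rw [ht, htc] at hI
  obtain hle | hlt := le_or_gt (2 * #t) #s
  · exact ⟨t, hts, hle, hI⟩
  · refine ⟨s \ t, sdiff_subset, ?_, ?_⟩
    · rw [card_sdiff_of_subset hts]
      omega
    · rwa [Finset.sdiff_sdiff_eq_self hts, Set.inter_comm]

theorem convexIndependent_iff_exists_lt {ι E : Type*} [Finite ι] [AddCommGroup E] [Module ℝ E]
    [TopologicalSpace E] [IsTopologicalAddGroup E] [ContinuousSMul ℝ E] [LocallyConvexSpace ℝ E]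
    [T2Space E] {q : ι → E} :
    ConvexIndependent ℝ q ↔ ∀ i, ∃ f : E →ₗ[ℝ] ℝ, ∀ j ≠ i, f (q j) < f (q i) := by
  rw [convexIndependent_iff_notMem_convexHull_sdiff]
  constructor
  · intro h i
    have hclosed := (Set.toFinite (q '' (Set.univ \ {i}))).isClosed_convexHull ℝ
    obtain ⟨f, c, hlt, hc⟩ :=
      geometric_hahn_banach_closed_point (convex_convexHull ℝ _) hclosed (h i Set.univ)
    exact ⟨f, fun j hj => (hlt _ (subset_convexHull ℝ _ ⟨j, ⟨trivial, hj⟩, rfl⟩)).trans hc⟩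
  · intro h i s hi
    obtain ⟨f, hf⟩ := h i
    obtain ⟨_, ⟨j, hj, rfl⟩, hle⟩ :=
      (f.convexOn convex_univ).exists_ge_of_mem_convexHull (Set.subset_univ _) hi
    exact hle.not_gt (hf j hj.2)

end Convexity

section Exposed

variable {V : Type*} [AddCommGroup V] [Module ℝ V] {G : SimpleGraph V}

/-- The midpoint of every edge of `G` is exposed among all the edge midpoints, i.e. is the unique
maximiser of some linear functional; the factor `1 / 2` in the midpoints is dropped. -/
def EdgesExposed (G : SimpleGraph V) : Prop :=
  ∀ ⦃x y⦄, G.Adj x y → ∃ f : V →ₗ[ℝ] ℝ, ∀ z w, G.Adj z w → s(z, w) ≠ s(x, y) →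
    f z + f w < f x + f y

theorem EdgesExposed.exists_lt (h : EdgesExposed G) {x y : V} (hxy : G.Adj x y) :
    ∃ f : V →ₗ[ℝ] ℝ, (∀ z, G.Adj x z → z ≠ y → f z < f y) ∧
      (∀ z, G.Adj y z → z ≠ x → f z < f x) := by
  obtain ⟨f, hf⟩ := h hxy
  refine ⟨f, fun z hz hzy => ?_, fun z hz hzx => ?_⟩
  · exact lt_of_add_lt_add_left (hf x z hz (Sym2.congr_right.not.2 hzy))
  · exact lt_of_add_lt_add_right (hf z y hz.symm (Sym2.congr_left.not.2 hzx))

theorem EdgesExposed.notMem_convexHull_neighborSet (h : EdgesExposed G) {x y : V}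
    (hxy : G.Adj x y) : y ∉ convexHull ℝ (G.neighborSet x \ {y}) := by
  intro hy
  obtain ⟨f, hfy, -⟩ := h.exists_lt hxy
  obtain ⟨z, ⟨hxz, hzy⟩, hle⟩ :=
    (f.convexOn convex_univ).exists_ge_of_mem_convexHull (Set.subset_univ _) hy
  exact hle.not_gt (hfy z hxz hzy)

theorem EdgesExposed.disjoint_segment_convexHull (h : EdgesExposed G) {x y : V}
    (hxy : G.Adj x y) : Disjoint (segment ℝ x y) (convexHull ℝ (G.commonNeighbors x y)) := by
  rw [Set.disjoint_left]
  intro q hq hq'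
  obtain ⟨f, hfy, hfx⟩ := h.exists_lt hxy
  have hmin : min (f x) (f y) ≤ f q :=
    (f.concaveOn convex_univ).min_le_of_mem_segment trivial trivial hq
  obtain ⟨z, ⟨hxz, hyz⟩, hle⟩ :=
    (f.convexOn convex_univ).exists_ge_of_mem_convexHull (Set.subset_univ _) hq'
  exact (hmin.trans hle).not_gt (lt_min (hfx z hyz hxz.ne') (hfy z hxz hyz.ne'))

variable [FiniteDimensional ℝ V] [DecidableEq V]

theorem EdgesExposed.exists_mem_convexHull_erase (h : EdgesExposed G) {s : Finset V}
    (hs : G.IsClique (s : Set V)) (hfin : Module.finrank ℝ V + 2 ≤ #s) (hcard : #s ≤ 5) :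
    ∃ v ∈ s, v ∈ convexHull ℝ (s.erase v : Set V) := by
  obtain ⟨t, hts, ht, q, hqt, hqs⟩ := exists_subset_inter_convexHull_sdiff_nonempty hfin
  obtain h0 | h1 | h2 : #t = 0 ∨ #t = 1 ∨ #t = 2 := by omega
  · simp [card_eq_zero.1 h0] at hqt
  · obtain ⟨v, rfl⟩ := card_eq_one.1 h1
    rw [coe_singleton, convexHull_singleton, Set.mem_singleton_iff] at hqt
    rw [sdiff_singleton_eq_erase, hqt] at hqs
    exact ⟨v, hts (mem_singleton_self v), hqs⟩
  · obtain ⟨x, y, hxy, rfl⟩ := card_eq_two.1 h2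
    have hx : x ∈ s := hts (by simp)
    have hy : y ∈ s := hts (by simp)
    rw [coe_pair, convexHull_pair] at hqt
    refine absurd (convexHull_mono ?_ hqs)
      (Set.disjoint_left.1 (h.disjoint_segment_convexHull (hs hx hy hxy)) hqt)
    intro z hz
    obtain ⟨hzs, hzx, hzy⟩ : z ∈ s ∧ z ≠ x ∧ z ≠ y := by simpa using hz
    exact ⟨hs hx hzs hzx.symm, hs hy hzs hzy.symm⟩

theorem EdgesExposed.exists_unique_common_neighbor (h : EdgesExposed G)
    (hV : Module.finrank ℝ V ≤ 3) {s : Finset V} (hs : G.IsNClique 5 s) :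
    ∃ v ∈ s, ∀ w, (∀ u ∈ s.erase v, G.Adj w u) → w = v := by
  have hcentre {s : Finset V} (hs : G.IsNClique 5 s) :=
    h.exists_mem_convexHull_erase hs.isClique (by rw [hs.card_eq]; omega) hs.card_eq.le
  obtain ⟨v, hvs, hv⟩ := hcentre hs
  refine ⟨v, hvs, fun w hw => ?_⟩
  by_contra hwv
  have hws : w ∉ s.erase v := fun hws => G.loopless.irrefl w (hw w hws)
  obtain ⟨u, hu, hu'⟩ := hcentre ((hs.erase_of_mem hvs).insert hw)
  obtain ⟨k, hk, hvk⟩ :=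
    exists_mem_convexHull_insert_erase_of_mem_convexHull_erase hv hws hu hu'
  have hks := mem_of_mem_erase hk
  refine h.notMem_convexHull_neighborSet (hs.isClique hks hvs (ne_of_mem_erase hk))
    (convexHull_mono ?_ hvk)
  rintro z (rfl | hz)
  · exact ⟨(hw k hk).symm, hwv⟩
  · obtain ⟨⟨hzs, hzv⟩, hzk⟩ : (z ∈ s ∧ z ≠ v) ∧ z ≠ k := by simpa using hz
    exact ⟨hs.isClique hks hzs hzk.symm, hzv⟩

end Exposed

section Counting

variable {W : Type*} (G : SimpleGraph W) [DecidableRel G.Adj]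

theorem card_interedges_eq_sum (A B : Finset W) :
    #(G.interedges A B) = ∑ x ∈ A, #{y ∈ B | G.Adj x y} := by
  rw [G.interedges_def, card_filter, sum_product]
  simp only [card_filter]

theorem card_interedges_self_le (Q : Finset W) : #(G.interedges Q Q) ≤ #Q * (#Q - 1) := by
  calc
    #(G.interedges Q Q) ≤ #Q.offDiag := card_le_card fun e he => by
      obtain ⟨h1, h2, hadj⟩ := (G.mem_interedges_iff).1 he
      exact mem_offDiag.2 ⟨h1, h2, hadj.ne⟩
    _ = #Q * (#Q - 1) := by rw [offDiag_card, Nat.mul_sub_one]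

theorem two_mul_card_edgeFinset_induce (U : Finset W) :
    2 * #(G.induce (U : Set W)).edgeFinset = #(G.interedges U U) := by
  rw [SimpleGraph.two_mul_card_edgeFinset]
  refine card_nbij (Prod.map (↑) (↑)) ?_
    (Subtype.val_injective.prodMap Subtype.val_injective).injOn ?_
  · rintro ⟨x, y⟩ h
    simpa [G.mem_interedges_iff] using h
  · rintro ⟨x, y⟩ h
    obtain ⟨hx, hy, hxy⟩ := G.mem_interedges_iff.1 h
    exact ⟨(⟨x, hx⟩, ⟨y, hy⟩), by simpa using hxy, rfl⟩

theorem mul_card_interedges_self_le_of_cliqueFreeOn {U : Finset W} {r : ℕ}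
    (h : G.CliqueFreeOn U (r + 1)) : r * #(G.interedges U U) ≤ (r - 1) * #U ^ 2 := by
  have hcard : Fintype.card (U : Set W) = #U := Fintype.card_coe U
  have hle := ((G.cliqueFree_induce_iff U (r + 1)).2 h).card_edgeFinset_le
  dsimp only at hle
  rw [← SimpleGraph.card_edgeFinset_turanGraph, hcard] at hle
  calc
    r * #(G.interedges U U) = 2 * r * #(G.induce (U : Set W)).edgeFinset := by
      rw [← two_mul_card_edgeFinset_induce]
      ring
    _ ≤ 2 * r * #(SimpleGraph.turanGraph #U r).edgeFinset := by gcongr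
    _ ≤ (r - 1) * #U ^ 2 := SimpleGraph.mul_card_edgeFinset_turanGraph_le

theorem two_mul_card_le_card_interedges_self {P : Finset W} {S : Finset (Sym2 W)}
    (hSP : S ⊆ P.sym2) (hSG : (S : Set (Sym2 W)) ⊆ G.edgeSet) :
    2 * #S ≤ #(G.interedges P P) := by
  classical
  have hS : ∀ e ∈ S, 2 ≤ #{a ∈ G.interedges P P | s(a.1, a.2) = e} := by
    intro e he
    induction e with | _ x y
    obtain ⟨hx, hy⟩ := mk_mem_sym2_iff.1 (hSP he)
    have hxy : G.Adj x y := hSG he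
    rw [← card_pair (a := (x, y)) (b := (y, x)) fun h => hxy.ne (Prod.ext_iff.1 h).1]
    refine card_le_card (insert_subset_iff.2 ⟨?_, singleton_subset_iff.2 ?_⟩)
    · exact mem_filter.2 ⟨G.mem_interedges_iff.2 ⟨hx, hy, hxy⟩, rfl⟩
    · exact mem_filter.2 ⟨G.mem_interedges_iff.2 ⟨hy, hx, hxy.symm⟩, Sym2.eq_swap⟩
  calc
    2 * #S = ∑ e ∈ S, 2 := by rw [sum_const, smul_eq_mul, mul_comm]
    _ ≤ ∑ e ∈ S, #{a ∈ G.interedges P P | s(a.1, a.2) = e} := sum_le_sum hS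
    _ ≤ #(G.interedges P P) :=
      (sum_card_fiberwise_eq_card_filter _ _ _).trans_le (card_filter_le _ _)

theorem card_interedges_le_of_unique_common_neighbor {v : W} {A Q : Finset W}
    (h : ∀ w ∈ A, (∀ u ∈ Q, G.Adj w u) → w = v) :
    #(G.interedges A Q) ≤ (#Q - 1) * #A + 1 := by
  classical
  have hle : ∀ w ∈ A, #{u ∈ Q | G.Adj w u} ≤ #Q - 1 + if w = v then 1 else 0 := by
    intro w hw
    split_ifs with hwv
    · exact (card_filter_le _ _).trans le_tsub_add
    · refine Nat.le_sub_one_of_lt ((card_filter_le _ _).lt_of_ne fun hcard => hwv (h w hw ?_))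
      exact card_filter_eq_iff.1 hcard
  calc
    #(G.interedges A Q) = ∑ w ∈ A, #{u ∈ Q | G.Adj w u} := card_interedges_eq_sum G A Q
    _ ≤ ∑ w ∈ A, (#Q - 1 + if w = v then 1 else 0) := sum_le_sum hle
    _ = (#Q - 1) * #A + if v ∈ A then 1 else 0 := by
      rw [sum_add_distrib, sum_const, smul_eq_mul, mul_comm, sum_ite_eq']
    _ ≤ (#Q - 1) * #A + 1 := by
      gcongr
      split_ifs <;> simp

variable [DecidableEq W]

theorem card_interedges_self_eq_add {Q U : Finset W} (hQU : Q ⊆ U) :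
    #(G.interedges U U) = #(G.interedges (U \ Q) (U \ Q)) + 2 * #(G.interedges (U \ Q) Q) +
      #(G.interedges Q Q) := by
  have hleft (B : Finset W) :
      #(G.interedges U B) = #(G.interedges (U \ Q) B) + #(G.interedges Q B) := by
    simp only [card_interedges_eq_sum, sum_sdiff hQU]
  have := G.symm
  have hcomm (A B : Finset W) : #(G.interedges A B) = #(G.interedges B A) :=
    Rel.card_interedges_comm A B
  rw [hleft, hcomm _ U, hleft, hcomm Q U, hleft, hcomm Q (U \ Q)]
  ring

theorem mul_card_interedges_self_le {r : ℕ}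
    (h : ∀ s, G.IsNClique (r + 1) s → ∃ v ∈ s, ∀ w, (∀ u ∈ s.erase v, G.Adj w u) → w = v)
    (U : Finset W) : r * #(G.interedges U U) ≤ (r - 1) * #U ^ 2 + 2 * #U := by
  obtain rfl | hr := r.eq_zero_or_pos
  · simp only [zero_mul, zero_le]
  induction U using Finset.strongInduction with | _ U ih
  by_cases hU : G.CliqueFreeOn U (r + 1)
  · exact (mul_card_interedges_self_le_of_cliqueFreeOn G hU).trans le_self_add
  obtain ⟨s, hsU, hs⟩ : ∃ s : Finset W, s ⊆ U ∧ G.IsNClique (r + 1) s := by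
    simpa [SimpleGraph.CliqueFreeOn] using hU
  obtain ⟨v, hvs, hv⟩ := h s hs
  set Q := s.erase v
  have hQU : Q ⊆ U := (erase_subset v s).trans hsU
  have hQr : #Q = r := (hs.erase_of_mem hvs).card_eq
  have hrec := ih (U \ Q) (sdiff_ssubset hQU (card_pos.1 (hQr.symm ▸ hr)))
  have hcross := card_interedges_le_of_unique_common_neighbor G (A := U \ Q) fun w _ => hv w
  have hinner := card_interedges_self_le G Q
  rw [hQr] at hcross hinner
  rw [card_interedges_self_eq_add G hQU, ← card_sdiff_add_card_eq_card hQU, hQr]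
  calc
    _ = r * #(G.interedges (U \ Q) (U \ Q)) + 2 * r * #(G.interedges (U \ Q) Q) +
        r * #(G.interedges Q Q) := by ring
    _ ≤ ((r - 1) * #(U \ Q) ^ 2 + 2 * #(U \ Q)) + 2 * r * ((r - 1) * #(U \ Q) + 1) +
        r * (r * (r - 1)) := by gcongr
    _ = (r - 1) * (#(U \ Q) + r) ^ 2 + 2 * (#(U \ Q) + r) := by ring

end Counting

section Midpoints

variable {d : ℕ}

theorem map_pairMidpoint (f : EuclideanSpace ℝ (Fin d) →ₗ[ℝ] ℝ) (x y : EuclideanSpace ℝ (Fin d)) :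
    f (pairMidpoint s(x, y)) = (f x + f y) / 2 := by
  simp only [pairMidpoint, Sym2.lift_mk, midpoint_eq_smul_add, map_smul, map_add, smul_eq_mul,
    invOf_eq_inv]
  ring

theorem midpointsConvexIndependent_iff_edgesExposed {G : SimpleGraph (EuclideanSpace ℝ (Fin d))}
    {S : Finset (Sym2 (EuclideanSpace ℝ (Fin d)))} (hS : (S : Set (Sym2 _)) = G.edgeSet) :
    MidpointsConvexIndependent S ↔ EdgesExposed G := by
  have hmem (x y : EuclideanSpace ℝ (Fin d)) : s(x, y) ∈ S ↔ G.Adj x y := by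
    rw [← mem_coe, hS, G.mem_edgeSet]
  rw [MidpointsConvexIndependent, convexIndependent_iff_exists_lt]
  simp only [Subtype.forall, Sym2.forall, hmem, ne_eq, Subtype.mk.injEq, map_pairMidpoint,
    div_lt_div_iff_of_pos_right (zero_lt_two' ℝ)]
  rfl

theorem card_edgeFinset_le_E (hd : 0 < d) {W : Type*} [Fintype W] {G : SimpleGraph W}
    [DecidableRel G.Adj] (p : W ↪ EuclideanSpace ℝ (Fin d)) (h : EdgesExposed (G.map p)) :
    #G.edgeFinset ≤ E d (Fintype.card W) := by
  classical
  set S := G.edgeFinset.map p.sym2Map with hS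
  have hSG : (S : Set (Sym2 _)) = (G.map p).edgeSet := by
    rw [SimpleGraph.edgeSet_map, hS, coe_map, SimpleGraph.coe_edgeFinset]
  have hSP : S ⊆ pairs (univ.map p) := by
    intro e he
    obtain ⟨e, heG, rfl⟩ := mem_map.1 he
    induction e with | _ x y
    have hxy : p x ≠ p y := p.injective.ne (SimpleGraph.mem_edgeFinset.1 heG).ne
    exact mem_filter.2 ⟨mk_mem_sym2_iff.2 ⟨by simp, by simp⟩, Sym2.mk_isDiag_iff.not.2 hxy⟩
  have hSC := (midpointsConvexIndependent_iff_edgesExposed hSG).2 h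
  calc
    #G.edgeFinset = #S := (card_map _).symm
    _ ≤ maxPairs (univ.map p) := le_sup (f := card) (mem_filter.2 ⟨mem_powerset.2 hSP, hSC⟩)
    _ ≤ E d (Fintype.card W) := (isGreatest_E d _ hd).2 ⟨_, card_map p, rfl⟩

theorem eight_mul_card_le (hd : d ≤ 3) {P : Finset (EuclideanSpace ℝ (Fin d))}
    {S : Finset (Sym2 (EuclideanSpace ℝ (Fin d)))} (hSP : S ⊆ pairs P)
    (hS : MidpointsConvexIndependent S) : 8 * #S ≤ 3 * #P ^ 2 + 2 * #P := by
  classical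
  set G := SimpleGraph.fromEdgeSet (S : Set (Sym2 (EuclideanSpace ℝ (Fin d))))
  have hSG : (S : Set (Sym2 _)) = G.edgeSet := by
    rw [SimpleGraph.edgeSet_fromEdgeSet, eq_comm, sdiff_eq_left, Set.disjoint_left]
    exact fun e he => (mem_filter.1 (hSP he)).2
  have hG : EdgesExposed G := (midpointsConvexIndependent_iff_edgesExposed hSG).1 hS
  have hcard := mul_card_interedges_self_le G (r := 4)
    (fun s => hG.exists_unique_common_neighbor (by simpa using hd)) P
  have hS := two_mul_card_le_card_interedges_self G (hSP.trans (filter_subset _ _)) hSG.le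
  omega

theorem eight_mul_E_le (hd : d ≤ 3) (n : ℕ) : 8 * E d n ≤ 3 * n ^ 2 + 2 * n := by
  classical
  rw [mul_comm, ← Nat.le_div_iff_mul_le (by norm_num)]
  refine csSup_le' ?_
  rintro _ ⟨P, rfl, rfl⟩
  refine Finset.sup_le fun S hS => ?_
  obtain ⟨hSP, hS⟩ := mem_filter.1 hS
  rw [Nat.le_div_iff_mul_le (by norm_num), mul_comm]
  exact eight_mul_card_le hd (mem_powerset.1 hSP) hS

end Midpoints

section Construction

theorem edgesExposed_map_of_isCompleteMultipartite {W V : Type*} [AddCommGroup V] [Module ℝ V]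
    {G : SimpleGraph W} (hG : G.IsCompleteMultipartite) (p : W ↪ V)
    (h : ∀ x y, G.Adj x y → ∃ f : V →ₗ[ℝ] ℝ, (∀ z, G.Adj x z → z ≠ y → f (p z) < f (p y)) ∧
      (∀ z, G.Adj y z → z ≠ x → f (p z) < f (p x))) :
    EdgesExposed (G.map p) := by
  intro _ _ hmap
  obtain ⟨x, y, hxy, rfl, rfl⟩ := (SimpleGraph.map_adj p G _ _).1 hmap
  obtain ⟨f, hfy, hfx⟩ := h x y hxy
  have hle {z w : W} (hxz : G.Adj x z) (hyw : G.Adj y w) (hzw : s(z, w) ≠ s(x, y)) :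
      f (p z) + f (p w) < f (p x) + f (p y) := by
    obtain rfl | hzy := eq_or_ne z y
    · have hwx : w ≠ x := fun hwx => hzw (by rw [hwx, Sym2.eq_swap])
      linarith [hfx w hyw hwx]
    · obtain rfl | hwx := eq_or_ne w x
      · linarith [hfy z hxz hzy]
      · linarith [hfy z hxz hzy, hfx w hyw hwx]
  refine ⟨f, ?_⟩
  intro _ _ hmap hne
  obtain ⟨z, w, hzw, rfl, rfl⟩ := (SimpleGraph.map_adj p G _ _).1 hmap
  have hne' : s(z, w) ≠ s(x, y) := fun heq => hne (congrArg (Sym2.map p) heq)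
  have hor {a b : W} (hab : G.Adj a b) (c : W) : G.Adj a c ∨ G.Adj c b :=
    or_iff_not_and_not.2 fun h => hG.trans a c b h.1 h.2 hab
  have hmatch : G.Adj x z ∧ G.Adj y w ∨ G.Adj x w ∧ G.Adj y z := by
    have hz := hor hxy z
    have hw := hor hxy w
    have hx := hor hzw x
    grind [G.adj_comm]
  obtain ⟨hxz, hyw⟩ | ⟨hxw, hyz⟩ := hmatch
  · exact hle hxz hyw hne'
  · rw [add_comm (f (p z))]
    exact hle hxw hyz (Sym2.eq_swap.trans_ne hne')

/-- The point with parameter `t` on the `c`-th of the three congruent parabola arcs that carry the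
lower bound construction; the arc leaves the `c`-th standard basis vector at `t = 0`. -/
noncomputable def arcPoint (c : Fin 3) (t : ℝ) : EuclideanSpace ℝ (Fin 3) :=
  WithLp.toLp 2 fun i => if i = c then 1 + t - t ^ 2 else -t

theorem arcPoint_self (c : Fin 3) (t : ℝ) : arcPoint c t c = 1 + t - t ^ 2 :=
  if_pos rfl

theorem arcPoint_of_ne {c i : Fin 3} (h : i ≠ c) (t : ℝ) : arcPoint c t i = -t :=
  if_neg h

theorem exists_ne_and_ne : ∀ c d : Fin 3, ∃ e, e ≠ c ∧ e ≠ d := by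
  decide

theorem eq_of_arcPoint_eq {c d : Fin 3} {s t : ℝ} (h : arcPoint c s = arcPoint d t) : s = t := by
  obtain ⟨i, hic, hid⟩ := exists_ne_and_ne c d
  simpa only [arcPoint_of_ne hic, arcPoint_of_ne hid, neg_inj] using congrArg (· i) h

/-- The functional exposing the midpoint of `arcPoint c s` and `arcPoint d r`, where `e` is the
remaining coordinate: the coefficient of `e` is the one for which the maximum on arc `c` is attained
at `s` and that on arc `d` at `r`. -/
noncomputable def arcFunctional (c d e : Fin 3) (s r : ℝ) : EuclideanSpace ℝ (Fin 3) →ₗ[ℝ] ℝ :=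
  (1 - r) • EuclideanSpace.projₗ c + (1 - s) • EuclideanSpace.projₗ d -
    (s * (1 - r) + r * (1 - s)) • EuclideanSpace.projₗ e

theorem arcFunctional_comm (c d e : Fin 3) (s r : ℝ) :
    arcFunctional c d e s r = arcFunctional d c e r s := by
  rw [arcFunctional, arcFunctional, add_comm (_ • _), add_comm (_ * _)]

theorem arcFunctional_apply (c d e : Fin 3) (s r : ℝ) (x : EuclideanSpace ℝ (Fin 3)) :
    arcFunctional c d e s r x =
      (1 - r) * x c + (1 - s) * x d - (s * (1 - r) + r * (1 - s)) * x e :=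
  rfl

theorem arcFunctional_arcPoint_lt {c d e b : Fin 3} (hcd : c ≠ d) (hec : e ≠ c) (hed : e ≠ d)
    {s r t : ℝ} (hs : s ∈ Set.Ico 0 1) (hr : r ∈ Set.Ico 0 1) (ht : t ∈ Set.Ico 0 1) (hb : b ≠ d)
    (hne : (b, t) ≠ (c, s)) :
    arcFunctional c d e s r (arcPoint b t) < arcFunctional c d e s r (arcPoint c s) := by
  have hr' : 0 < 1 - r := sub_pos.2 hr.2
  have hs' : 0 < 1 - s := sub_pos.2 hs.2
  have hc (t : ℝ) :
      arcFunctional c d e s r (arcPoint c t) = (1 - r) * (1 + s ^ 2 - (t - s) ^ 2) := by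
    rw [arcFunctional_apply, arcPoint_self, arcPoint_of_ne hcd.symm, arcPoint_of_ne hec]
    ring
  obtain rfl | rfl : b = c ∨ b = e := by omega
  · have hts : t - s ≠ 0 := sub_ne_zero.2 fun hts => hne (by rw [hts])
    have hts' : 0 < (t - s) ^ 2 := by positivity
    rw [hc, hc, sub_self]
    exact mul_lt_mul_of_pos_left (by linarith) hr'
  · calc
      arcFunctional c d b s r (arcPoint b t) =
          -((1 - r) * t + (1 - s) * t + (s * (1 - r) + r * (1 - s)) * (1 + t * (1 - t))) := by
        rw [arcFunctional_apply, arcPoint_self, arcPoint_of_ne hec.symm, arcPoint_of_ne hed.symm]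
        ring
      _ ≤ 0 := by
        have hs0 := hs.1
        have hr0 := hr.1
        have ht0 := ht.1
        have ht' : 0 ≤ 1 - t := sub_nonneg.2 ht.2.le
        exact neg_nonpos.2 (by positivity)
      _ < arcFunctional c d b s r (arcPoint c s) := by
        rw [hc, sub_self]
        exact mul_pos hr' (by nlinarith)

theorem sq_div_three_le_card_edgeFinset_turanGraph (n : ℕ) :
    n ^ 2 / 3 ≤ #(SimpleGraph.turanGraph n 3).edgeFinset := by
  rw [SimpleGraph.card_edgeFinset_turanGraph]
  have hlt : n % 3 < 3 := Nat.mod_lt _ (by norm_num)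
  have hle : (n % 3) ^ 2 ≤ n ^ 2 := Nat.pow_le_pow_left (Nat.mod_le _ _) 2
  have hmod : n ^ 2 % 3 = (n % 3) ^ 2 % 3 := Nat.pow_mod _ _ _
  generalize n % 3 = r at hlt hle hmod ⊢
  interval_cases r <;> simp only [Nat.choose] <;> omega

theorem isCompleteMultipartite_turanGraph (n r : ℕ) :
    (SimpleGraph.turanGraph n r).IsCompleteMultipartite where
  trans a b c hab hbc := by
    rw [SimpleGraph.turanGraph_adj, not_not] at *
    exact hab.trans hbc

theorem sq_div_three_le_E (n : ℕ) : n ^ 2 / 3 ≤ E 3 n := by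
  let c (i : Fin n) : Fin 3 := ⟨i % 3, Nat.mod_lt _ (by norm_num)⟩
  let t (i : Fin n) : ℝ := i / n
  have hn (i : Fin n) : (0 : ℝ) < n := by exact_mod_cast i.pos
  have ht (i : Fin n) : t i ∈ Set.Ico 0 1 :=
    ⟨by positivity, (div_lt_one (hn i)).2 (by exact_mod_cast i.2)⟩
  have ht_inj : t.Injective := fun i j hij =>
    Fin.ext (by exact_mod_cast (div_left_inj' (hn i).ne').1 hij)
  let p : Fin n ↪ EuclideanSpace ℝ (Fin 3) :=
    ⟨fun i => arcPoint (c i) (t i), fun i j hij => ht_inj (eq_of_arcPoint_eq hij)⟩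
  have hexposed : EdgesExposed ((SimpleGraph.turanGraph n 3).map p) := by
    refine edgesExposed_map_of_isCompleteMultipartite (isCompleteMultipartite_turanGraph n 3) p ?_
    have hc {i j : Fin n} (hij : (SimpleGraph.turanGraph n 3).Adj i j) : c i ≠ c j :=
      fun hc => SimpleGraph.turanGraph_adj.1 hij (Fin.mk.inj_iff.1 hc)
    have hne {i j : Fin n} (hij : i ≠ j) : (c i, t i) ≠ (c j, t j) :=
      fun h => hij (ht_inj (Prod.ext_iff.1 h).2)
    intro x y hxy
    obtain ⟨e, hex, hey⟩ := exists_ne_and_ne (c x) (c y)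
    refine ⟨arcFunctional (c x) (c y) e (t x) (t y), fun z hxz hzy => ?_, fun z hyz hzx => ?_⟩
    · rw [arcFunctional_comm]
      exact arcFunctional_arcPoint_lt (hc hxy).symm hey hex (ht y) (ht x) (ht z) (hc hxz).symm
        (hne hzy)
    · exact arcFunctional_arcPoint_lt (hc hxy) hex hey (ht x) (ht y) (ht z) (hc hyz).symm (hne hzx)
  calc
    n ^ 2 / 3 ≤ #(SimpleGraph.turanGraph n 3).edgeFinset :=
      sq_div_three_le_card_edgeFinset_turanGraph n
    _ ≤ E 3 (Fintype.card (Fin n)) := card_edgeFinset_le_E (by norm_num) p hexposed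
    _ = E 3 n := by rw [Fintype.card_fin]

end Construction

theorem natCast_le_rpow {x : ℝ} (hx : 1 ≤ x) (n : ℕ) : (n : ℝ) ≤ (n : ℝ) ^ x := by
  obtain rfl | hn := n.eq_zero_or_pos
  · rw [Nat.cast_zero, Real.zero_rpow (by positivity)]
  · exact Real.self_le_rpow_of_one_le (by exact_mod_cast hn) hx

end MidpointGraphs

theorem theorem2_general :
    (∀ n : ℕ, ⌊(1 / 3 : ℝ) * (n : ℝ) ^ 2⌋₊ ≤ MidpointGraphs.E 3 n) ∧
    ∀ n : ℕ, (MidpointGraphs.E 3 n : ℝ) ≤ (3 / 8 : ℝ) * (n : ℝ) ^ 2 + 1 / 4 * n := by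
  refine ⟨fun n => ?_, fun n => ?_⟩
  · have hdiv : (1 / 3 : ℝ) * (n : ℝ) ^ 2 = ((n ^ 2 : ℕ) : ℝ) / ((3 : ℕ) : ℝ) := by
      push_cast
      ring
    rw [hdiv, Nat.floor_div_eq_div]
    exact MidpointGraphs.sq_div_three_le_E n
  · have h : (8 : ℝ) * MidpointGraphs.E 3 n ≤ 3 * (n : ℝ) ^ 2 + 2 * n := by
      exact_mod_cast MidpointGraphs.eight_mul_E_le le_rfl n
    linarith

theorem theorem2 :
    (∀ n : ℕ, ⌊(1 / 3 : ℝ) * (n : ℝ) ^ 2⌋₊ ≤ MidpointGraphs.E 3 n) ∧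
    (∃ C : ℝ, ∀ n : ℕ,
      (MidpointGraphs.E 3 n : ℝ) ≤ (3 / 8 : ℝ) * (n : ℝ) ^ 2 + C * (n : ℝ) ^ (3 / 2 : ℝ)) := by
  refine ⟨theorem2_general.1, 1 / 4, fun n => (theorem2_general.2 n).trans ?_⟩
  gcongr
  exact MidpointGraphs.natCast_le_rpow (by norm_num) n
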